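/- Let $D\ge 0$ be an integer ($D=2s$ for spin $s$) and, for $N\ge 1$, let $\mathcal H_N=(\mathbb C^{D+1})^{\otimes N}$, with $\mathcal P_N\subset\mathcal H_N$ the subspace of vectors invariant under all permutations of the $N$ tensor factors. A pure permutation-symmetric state on $N$ sites is a linear map $\mathrm{End}(\mathcal H_N)\to\mathbb C$ of the form $\mathcal O\mapsto\langle\Phi|\mathcal O|\Phi\rangle/\langle\Phi|\Phi\rangle$ with $0\ne\Phi\in\mathcal P_N$; let $\mathtt P_N$ be the set of these maps. Let $\mathcal A$ be the space of finitely supported operators, i.e. the inductive limit of the spaces $\mathrm{End}(\mathcal H_N)$ along the embeddings $\mathcal O\mapsto\mathcal O\otimes\mathbf 1\otimes\cdots\otimes\mathbf 1$. Let $\mathtt P$ be the set of all linear maps $\psi:\mathcal A\to\mathbb C$ that are limits, in the local-operator topology, of sequences $\psi_N\in\mathtt P_N$; that is, for every $k$ and every $\mathcal O\in\mathrm{End}(\mathcal H_k)$, $$\psi(\mathcal O)=\lim_{N\to\infty}\psi_N(\mathcal O\otimes\mathbf 1^{\otimes(N-k)}).$$ For $v\in\mathbb{CP}^D$, represented by a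 nonzero vector $\vec v\in\mathbb C^{D+1}$, let $\psi_v\in\mathtt P$ be the zero-entanglement (product) state, the limit of the states given by the vectors $\vec v^{\,\otimes N}$: for $\mathcal O\in\mathrm{End}(\mathcal H_k)$, $$\psi_v(\mathcal O)=\frac{\langle\vec v^{\,\otimes k}|\mathcal O|\vec v^{\,\otimes k}\rangle}{\langle\vec v^{\,\otimes k}|\vec v^{\,\otimes k}\rangle}.$$ **Theorem.** (i) For every $\psi\in\mathtt P$ there is a Borel probability measure $\mu$ on $\mathbb{CP}^D$ such that $$\psi(\mathcal O)=\int_{\mathbb{CP}^D}d\mu(v)\,\psi_v(\mathcal O)\qquad\text{for every finitely supported }\mathcal O\in\mathcal A, \tag{$*$}$$ the integrand being $\mu$-integrable for every $\mathcal O$. (ii) Conversely, for every Borel probability measure $\mu$ on $\mathbb{CP}^D$ there is exactly one $\psi\in\mathtt P$ such that $(*)$ holds (with integrable integrand). -/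

import Mathlib

open MeasureTheory Filter Topology

noncomputable section

namespace SpinChain

/-- The local spin-`s` space `ℂ^(D+1)`, with `D = 2 s`. -/
abbrev Site (D : ℕ) : Type := EuclideanSpace ℂ (Fin (D + 1))

/-- The Hilbert space `(ℂ^(D+1))^{⊗ N}` of `N` sites, written in the product basis: a vector is
the family of its coefficients on the basis vectors `e_{σ 0} ⊗ ⋯ ⊗ e_{σ (N-1)}`, and these basis
vectors are orthonormal. -/
abbrev H (D N : ℕ) : Type := EuclideanSpace ℂ (Fin N → Fin (D + 1))

/-- The subspace `𝒫_N` of the vectors that are symmetric under all permutations of the sites. -/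
def symSubspace (D N : ℕ) : Submodule ℂ (H D N) where
  carrier := {Φ | ∀ (π : Equiv.Perm (Fin N)) (σ : Fin N → Fin (D + 1)), Φ (σ ∘ π) = Φ σ}
  add_mem' := by
    intro Φ Ψ hΦ hΨ π σ
    simp [hΦ π σ, hΨ π σ]
  zero_mem' := by
    intro π σ
    simp
  smul_mem' := by
    intro c Φ hΦ π σ
    simp [hΦ π σ]

/-- The quantum state `O ↦ ⟨Φ|O|Φ⟩ / ⟨Φ|Φ⟩` attached to a vector `Φ`
(used for `Φ ≠ 0` only), as a linear map on `End (H_N)`. -/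
def vectorState {D N : ℕ} (Φ : H D N) : Module.End ℂ (H D N) →ₗ[ℂ] ℂ where
  toFun O := inner ℂ Φ (O Φ) / inner ℂ Φ Φ
  map_add' A B := by simp [add_div]
  map_smul' c A := by simp [mul_div_assoc]

/-- The set of pure permutation symmetric quantum states on `N` sites. -/
def pureSymStates (D N : ℕ) : Set (Module.End ℂ (H D N) →ₗ[ℂ] ℂ) :=
  {φ | ∃ Φ ∈ symSubspace D N, Φ ≠ 0 ∧ φ = vectorState Φ}

/-- The configuration on `N` sites that is `τ` on the first `k` sites and `σ` on the others. -/
def overwrite {D N k : ℕ} (τ : Fin k → Fin (D + 1)) (σ : Fin N → Fin (D + 1)) :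
    Fin N → Fin (D + 1) :=
  fun i => if hi : (i : ℕ) < k then τ ⟨i, hi⟩ else σ i

/-- The vector of `H_k` that is left when, in `Φ`, the sites from `k` on are frozen at their values
in `σ`. -/
def slice {D N : ℕ} (k : ℕ) (Φ : H D N) (σ : Fin N → Fin (D + 1)) : H D k :=
  WithLp.toLp 2 fun τ => Φ (overwrite τ σ)

/-- The embedding `O ↦ O ⊗ 1 ⊗ ⋯ ⊗ 1` of `End (H_k)` into `End (H_N)`, for `k ≤ N`:
the operator `O` acts on the first `k` sites. -/
def embed (D k N : ℕ) (h : k ≤ N) : Module.End ℂ (H D k) →ₗ[ℂ] Module.End ℂ (H D N) where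
  toFun O :=
    { toFun := fun Φ => WithLp.toLp 2 fun σ => O (slice k Φ σ) (fun i => σ (Fin.castLE h i))
      map_add' := by
        intro Φ Ψ
        ext σ
        have : slice k (Φ + Ψ) σ = slice k Φ σ + slice k Ψ σ := by
          ext τ; simp [slice]
        simp [this]
      map_smul' := by
        intro c Φ
        ext σ
        have : slice k (c • Φ) σ = c • slice k Φ σ := by
          ext τ; simp [slice]
        simp [this] }
  map_add' := by
    intro A B
    ext Φ σ
    simp
  map_smul' := by
    intro c A
    ext Φ σ
    simp

/-- The space of finitely supported operators: the inductive limit of the spaces `End (H_N)` along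
the embeddings `O ↦ O ⊗ 1 ⊗ ⋯ ⊗ 1`. -/
abbrev LocalOp (D : ℕ) : Type :=
  Module.DirectLimit (fun N => Module.End ℂ (H D N)) (embed D)

/-- An operator on `k` sites, seen as a finitely supported operator. -/
abbrev toLocalOp (D k : ℕ) : Module.End ℂ (H D k) →ₗ[ℂ] LocalOp D :=
  Module.DirectLimit.of ℂ ℕ (fun N => Module.End ℂ (H D N)) (embed D) k

/-- Convergence `φ_N → ψ` as `N → ∞` in the local-operator topology: `φ_N (O) → ψ (O)` for every
finitely supported `O`. An operator `O` on `k` sites is evaluated on `φ_N` for `N = k + n ≥ k`. -/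
def IsLocalLimit {D : ℕ} (φ : ∀ N, Module.End ℂ (H D N) →ₗ[ℂ] ℂ) (ψ : LocalOp D →ₗ[ℂ] ℂ) : Prop :=
  ∀ (k : ℕ) (O : Module.End ℂ (H D k)),
    Tendsto (fun n => φ (k + n) (embed D k (k + n) (Nat.le_add_right k n) O)) atTop
      (𝓝 (ψ (toLocalOp D k O)))

/-- The set `P` of permutation symmetric states in the thermodynamic limit: all limits, in the
local-operator topology, of sequences of pure permutation symmetric states on `N` sites. -/
def thermoStates (D : ℕ) : Set (LocalOp D →ₗ[ℂ] ℂ) :=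
  {ψ | ∃ φ : ∀ N, Module.End ℂ (H D N) →ₗ[ℂ] ℂ,
    (∀ N, φ N ∈ pureSymStates D N) ∧ IsLocalLimit φ ψ}

/-- The zero-entanglement vector `v ⊗ v ⊗ ⋯ ⊗ v` on `N` sites. -/
def prodVec {D : ℕ} (v : Site D) (N : ℕ) : H D N :=
  WithLp.toLp 2 fun σ => ∏ i, v (σ i)

theorem prodVec_mem_symSubspace {D : ℕ} (v : Site D) (N : ℕ) : prodVec v N ∈ symSubspace D N := by
  intro π σ
  exact Equiv.prod_comp π (fun i => v (σ i))

theorem prodVec_ne_zero {D : ℕ} {v : Site D} (hv : v ≠ 0) (N : ℕ) : prodVec v N ≠ 0 := by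
  obtain ⟨j, hj⟩ : ∃ j, v j ≠ 0 := by
    by_contra! h
    exact hv (by ext j; simpa using h j)
  intro h
  have h1 : (prodVec v N) (fun _ => j) = 0 := by rw [h]; rfl
  simp [prodVec] at h1
  exact hj h1.1

theorem prodVec_smul {D : ℕ} (t : ℂ) (v : Site D) (N : ℕ) :
    prodVec (t • v) N = t ^ N • prodVec v N := by
  ext σ
  simp [prodVec, Finset.prod_mul_distrib]

theorem vectorState_smul {D N : ℕ} {t : ℂ} (ht : t ≠ 0) (Φ : H D N) :
    vectorState (t • Φ) = vectorState Φ := by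
  apply LinearMap.ext
  intro O
  have ht' : (starRingEnd ℂ) t ≠ 0 := by simpa using ht
  simp only [vectorState, LinearMap.coe_mk, AddHom.coe_mk, map_smul, inner_smul_left,
    inner_smul_right]
  rw [mul_div_mul_left _ _ ht, mul_div_mul_left _ _ ht']

theorem inner_prodVec_add {D k m : ℕ} (v : Site D) (f : (Fin k → Fin (D + 1)) → ℂ)
    (Φ : H D (k + m))
    (hΦ : ∀ a b, Φ (Fin.append a b) = f a * ∏ i, v (b i)) :
    inner ℂ (prodVec v (k + m)) Φ =
      inner ℂ (prodVec v k) (WithLp.toLp 2 f) * inner ℂ (prodVec v m) (prodVec v m) := by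
  simp only [PiLp.inner_apply, RCLike.inner_apply]
  rw [← (Fin.appendEquiv k m).sum_comp, Fintype.sum_prod_type, Finset.sum_mul_sum]
  refine Finset.sum_congr rfl fun a _ => Finset.sum_congr rfl fun b _ => ?_
  simp only [Fin.appendEquiv, Equiv.coe_fn_mk, hΦ]
  simp [prodVec, Fin.prod_univ_add]
  ring

/-- For a zero-entanglement vector, the value of an operator does not depend on the number of
sites. -/
theorem vectorState_prodVec_embed {D : ℕ} {v : Site D} (hv : v ≠ 0) (k N : ℕ) (h : k ≤ N)
    (O : Module.End ℂ (H D k)) :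
    vectorState (prodVec v N) (embed D k N h O) = vectorState (prodVec v k) O := by
  obtain ⟨m, rfl⟩ := Nat.exists_eq_add_of_le h
  have hm : inner ℂ (prodVec v m) (prodVec v m) ≠ 0 := by
    rw [Ne, inner_self_eq_zero]
    exact prodVec_ne_zero hv m
  have h1 := inner_prodVec_add (m := m) v (fun a => (O (prodVec v k)) a)
    (embed D k (k + m) h O (prodVec v (k + m))) (by
      intro a b
      have hs : slice k (prodVec v (k + m)) (Fin.append a b) = (∏ i, v (b i)) • prodVec v k := by
        ext τ
        have ho : overwrite τ (Fin.append a b) = Fin.append τ b := by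
          funext i
          refine Fin.addCases (fun j => ?_) (fun j => ?_) i <;> simp [overwrite]
        simp only [slice, ho]
        simp [prodVec, Fin.prod_univ_add, mul_comm]
      have hr : (fun i => Fin.append a b (Fin.castLE h i)) = a := by
        funext i
        exact Fin.append_left a b i
      change (O (slice k (prodVec v (k + m)) (Fin.append a b)))
        (fun i => Fin.append a b (Fin.castLE h i)) = _
      rw [hs, hr]
      simp [mul_comm])
  have h2 := inner_prodVec_add (m := m) v (fun a => (prodVec v k) a) (prodVec v (k + m)) (by
      intro a b
      simp [prodVec, Fin.prod_univ_add])
  change inner ℂ (prodVec v (k + m)) (embed D k (k + m) h O (prodVec v (k + m))) /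
    inner ℂ (prodVec v (k + m)) (prodVec v (k + m)) =
    inner ℂ (prodVec v k) (O (prodVec v k)) / inner ℂ (prodVec v k) (prodVec v k)
  rw [h1, h2, mul_div_mul_right _ _ hm]

/-- Complex projective space `ℂP^D`. -/
abbrev CP (D : ℕ) : Type := Projectivization ℂ (Site D)

/-- The quotient topology from `ℂ^(D+1) ∖ {0}`. -/
instance (D : ℕ) : TopologicalSpace (CP D) :=
  inferInstanceAs (TopologicalSpace (Quotient (projectivizationSetoid ℂ (Site D))))

/-- The Borel `σ`-algebra. -/
instance (D : ℕ) : MeasurableSpace (CP D) := borel (CP D)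

instance (D : ℕ) : BorelSpace (CP D) := ⟨rfl⟩

/-- The zero-entanglement state on finitely supported operators that a nonzero vector `v` gives:
an operator `O` on `k` sites is sent to `⟨v ⋯ v|O|v ⋯ v⟩ / ⟨v ⋯ v|v ⋯ v⟩`. -/
def zeroEntStateOfVec {D : ℕ} (v : {v : Site D // v ≠ 0}) : LocalOp D →ₗ[ℂ] ℂ :=
  Module.DirectLimit.lift ℂ ℕ (fun N => Module.End ℂ (H D N)) (embed D)
    (fun N => vectorState (prodVec v.1 N))
    (fun k N h O => vectorState_prodVec_embed v.2 k N h O)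

/-- The zero-entanglement state `ψ_v` of a point `v` of `ℂP^D`. -/
def zeroEntState {D : ℕ} (p : CP D) : LocalOp D →ₗ[ℂ] ℂ :=
  Projectivization.lift (zeroEntStateOfVec (D := D)) (by
    intro a b t hab
    have ht : t ≠ 0 := by
      rintro rfl
      exact a.2 (by simpa using hab)
    apply Module.DirectLimit.hom_ext
    intro N
    apply LinearMap.ext
    intro O
    simp only [zeroEntStateOfVec, LinearMap.comp_apply, Module.DirectLimit.lift_of]
    rw [hab, prodVec_smul, vectorState_smul (pow_ne_zero N ht)]) p

/-- The state `ψ_v` is the limit, in the local-operator topology, of the states of the vectors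
`v ⊗ ⋯ ⊗ v`. -/
theorem isLocalLimit_zeroEntState {D : ℕ} (v : Site D) (hv : v ≠ 0) :
    IsLocalLimit (fun N => vectorState (prodVec v N))
      (zeroEntState (Projectivization.mk ℂ v hv : CP D)) := by
  intro k O
  have h : zeroEntState (Projectivization.mk ℂ v hv : CP D) (toLocalOp D k O) =
      vectorState (prodVec v k) O :=
    Module.DirectLimit.lift_of (fun N => vectorState (prodVec v N))
      (fun k N h O => vectorState_prodVec_embed hv k N h O) O
  rw [h]
  simp only [vectorState_prodVec_embed hv]
  exact tendsto_const_nhds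

/-- `ψ (O) = ∫ dμ(v) ψ_v (O)` for every finitely supported operator `O`, the integrals being
convergent. -/
def Represents {D : ℕ} (μ : Measure (CP D)) (ψ : LocalOp D →ₗ[ℂ] ℂ) : Prop :=
  ∀ O : LocalOp D, Integrable (fun v => zeroEntState v O) μ ∧ ψ O = ∫ v, zeroEntState v O ∂μ

end SpinChain

end

/-! A functional on local operators is determined by its marginals, the numbers `T k a b` it assigns
to the matrix units `|a⟩⟨b|` on `k` sites. (i) This is a quantum de Finetti theorem, by
Krein–Milman. Marginals of a limit of symmetric pure states are positive, compatible under partial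
trace, and invariant under permutations of the row index alone; such normalised families form a
compact convex set. If `T` is extreme, splitting `1 = P + (1 - P)` on one site, with `P` a rank-one
projection, splits `T` into two positive pieces, each of which must be a multiple of `T`: the site
decouples (`apply_cons_of_mem_extremePoints`). One-sided symmetry then makes the one-site matrix
rank one, so `T` is a product state of a unit vector. Mixtures of these form a compact convex set,
because probability measures on the unit sphere are weakly compact; hence they exhaust all states.
(ii) On boundedly many sites a mixture is close to a finite one `∑ w i ψ_{v i}` with distinct points
`v i`. The superposition `∑ √(w i) v i ⊗ ⋯ ⊗ v i` is symmetric, and its cross terms carry the factor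
`⟨v i, v j⟩ ^ n`, which tends to `0`. A diagonal choice over the precision yields one sequence for
the whole mixture. Uniqueness is immediate, since the integral prescribes every value. -/

noncomputable section

namespace SpinChain

open scoped ComplexOrder Matrix

/-! ### Bose-symmetric positive marginals and conditioning on one site -/

/-- A family of `k`-site matrices, one for each `k`. -/
abbrev Marginals (D : ℕ) : Type :=
  ∀ k : ℕ, (Fin k → Fin (D + 1)) → (Fin k → Fin (D + 1)) → ℂ

/-- The marginals of a (not normalised) positive functional on a Bose-symmetric infinite chain:
positive semidefinite, symmetric, and compatible under the partial trace of one site. -/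
structure IsBosePositive {D : ℕ} (T : Marginals D) : Prop where
  psd : ∀ k, (Matrix.of (T k)).PosSemidef
  symm : ∀ k (π : Equiv.Perm (Fin k)) a b, T k (a ∘ π) b = T k a b
  trace : ∀ k a b, ∑ c, T (k + 1) (Fin.cons c a) (Fin.cons c b) = T k a b

namespace IsBosePositive

variable {D : ℕ} {S T : Marginals D}

theorem star_apply (hT : IsBosePositive T) (k : ℕ) (a b : Fin k → Fin (D + 1)) :
    star (T k a b) = T k b a :=
  (hT.psd k).isHermitian.apply b a

theorem symm_right (hT : IsBosePositive T) (k : ℕ) (π : Equiv.Perm (Fin k))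
    (a b : Fin k → Fin (D + 1)) : T k a (b ∘ π) = T k a b := by
  rw [← hT.star_apply, hT.symm, hT.star_apply]

theorem add (hS : IsBosePositive S) (hT : IsBosePositive T) : IsBosePositive (S + T) where
  psd k := (hS.psd k).add (hT.psd k)
  symm k π a b := by simp [hS.symm, hT.symm]
  trace k a b := by simp [Finset.sum_add_distrib, hS.trace, hT.trace]

theorem smul (hT : IsBosePositive T) {r : ℝ} (hr : 0 ≤ r) : IsBosePositive (r • T) where
  psd k := by
    have : Matrix.of ((r • T) k) = (r : ℂ) • Matrix.of (T k) := by
      ext a b; simp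
    rw [this]
    exact (hT.psd k).smul (by exact_mod_cast hr)
  symm k π a b := by simp [hT.symm]
  trace k a b := by
    simp only [Pi.smul_apply, ← Finset.smul_sum, hT.trace]

theorem sum_diag (hT : IsBosePositive T) (k : ℕ) : ∑ a, T k a a = T 0 ![] ![] := by
  induction k with
  | zero =>
    rw [Fintype.sum_unique]
    exact congrArg₂ (T 0) (Subsingleton.elim _ _) (Subsingleton.elim _ _)
  | succ k ih =>
    rw [← ih, ← (Fin.consEquiv fun _ => Fin (D + 1)).sum_comp, Fintype.sum_prod_type,
      Finset.sum_comm]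
    exact Finset.sum_congr rfl fun a _ => hT.trace k a a

theorem diag_nonneg (hT : IsBosePositive T) (k : ℕ) (a : Fin k → Fin (D + 1)) :
    0 ≤ T k a a :=
  (hT.psd k).diag_nonneg

theorem diag_le (hT : IsBosePositive T) (k : ℕ) (a : Fin k → Fin (D + 1)) :
    T k a a ≤ T 0 ![] ![] := by
  rw [← hT.sum_diag k]
  exact Finset.single_le_sum (f := fun a => T k a a) (fun i _ => hT.diag_nonneg k i)
    (Finset.mem_univ a)

/-- The `2 × 2` minor on the indices `a`, `b` is nonnegative, and diagonal entries are at most the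
total mass. This gives compactness, and shows that a family of mass zero vanishes. -/
theorem norm_le (hT : IsBosePositive T) (k : ℕ) (a b : Fin k → Fin (D + 1)) :
    ‖T k a b‖ ≤ (T 0 ![] ![]).re := by
  have h := ((hT.psd k).submatrix ![a, b]).det_nonneg
  rw [Matrix.det_fin_two] at h
  simp only [Matrix.submatrix_apply, Matrix.of_apply, Matrix.cons_val_zero, Matrix.cons_val_one]
    at h
  rw [← hT.star_apply k a b] at h
  have hab : T k a b * star (T k a b) = ((‖T k a b‖ ^ 2 : ℝ) : ℂ) := by
    simpa using Complex.mul_conj' (T k a b)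
  have ha := Complex.le_def.1 (hT.diag_le k a)
  have hb := Complex.le_def.1 (hT.diag_le k b)
  have ha0 := Complex.le_def.1 (hT.diag_nonneg k a)
  have hb0 := Complex.le_def.1 (hT.diag_nonneg k b)
  rw [hab] at h
  have h' := (Complex.le_def.1 h).1
  simp only [Complex.zero_re, Complex.zero_im, Complex.sub_re, Complex.mul_re,
    Complex.ofReal_re] at h' ha0 hb0
  rw [← ha0.2, ← hb0.2] at h'
  refine abs_le_of_sq_le_sq' ?_ (ha0.1.trans ha.1) |>.2
  nlinarith [ha.1, hb.1, ha0.1, hb0.1]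

end IsBosePositive

/-- The marginals of the functional `O ↦ T (A ⊗ O)`. -/
def condition {D : ℕ} (A : Matrix (Fin (D + 1)) (Fin (D + 1)) ℂ) (T : Marginals D) :
    Marginals D :=
  fun k a b => ∑ c, ∑ d, A c d * T (k + 1) (Fin.cons c a) (Fin.cons d b)

theorem IsBosePositive.condition_one {D : ℕ} {T : Marginals D} (hT : IsBosePositive T) :
    condition 1 T = T := by
  funext k a b
  simp [condition, Matrix.one_apply, hT.trace]

theorem condition_add {D : ℕ} (A B : Matrix (Fin (D + 1)) (Fin (D + 1)) ℂ) (T : Marginals D) :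
    condition (A + B) T = condition A T + condition B T := by
  funext k a b
  simp [condition, add_mul, Finset.sum_add_distrib]

/-- Positivity is the Schur product theorem: the conditioned matrix is the compression of a Hadamard
product of `A`, read on the first site, with `T (k + 1)`. For the symmetry a permutation is extended
to fix the new first site; for the trace the first two sites are swapped. -/
theorem IsBosePositive.condition {D : ℕ} {T : Marginals D} (hT : IsBosePositive T)
    {A : Matrix (Fin (D + 1)) (Fin (D + 1)) ℂ} (hA : A.PosSemidef) :
    IsBosePositive (condition A T) where
  psd k := by
    -- Multiplication by `B` sums out the value at the first site.
    let B : Matrix (Fin (k + 1) → Fin (D + 1)) (Fin k → Fin (D + 1)) ℂ :=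
      Matrix.of fun f a => if Fin.tail f = a then (1 : ℂ) else 0
    suffices h : Matrix.of (SpinChain.condition A T k) =
        Bᴴ * Matrix.hadamard (A.submatrix (fun f => f 0) fun f => f 0)
          (Matrix.of (T (k + 1))) * B by
      rw [h]
      exact ((hA.submatrix fun f : Fin (k + 1) → Fin (D + 1) => f 0).hadamard
        (hT.psd (k + 1))).conjTranspose_mul_mul_same B
    have hB : ∀ (F : (Fin (k + 1) → Fin (D + 1)) → ℂ) a,
        ∑ f, F f * B f a = ∑ c, F (Fin.cons c a) := by
      intro F a
      have htail : ∀ (c : Fin (D + 1)) (x : Fin k → Fin (D + 1)),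
          Fin.tail (Fin.cons c x : Fin (k + 1) → Fin (D + 1)) = x :=
        fun c x => Fin.tail_cons (α := fun _ => Fin (D + 1)) c x
      rw [← (Fin.consEquiv fun _ => Fin (D + 1)).sum_comp, Fintype.sum_prod_type]
      simp [B, Fin.consEquiv, htail]
    have hstar : ∀ f a, Bᴴ a f = B f a := fun f a => by simp [B, Matrix.conjTranspose_apply]
    ext a b
    rw [Matrix.mul_apply, hB]
    simp only [Matrix.mul_apply, hstar]
    simp_rw [mul_comm (B _ a), hB]
    simp only [Matrix.hadamard_apply]
    rw [Finset.sum_comm]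
    rfl
  symm k π a b := by
    refine Finset.sum_congr rfl fun c _ => Finset.sum_congr rfl fun d _ => ?_
    have h : (Fin.cons c (a ∘ π) : Fin (k + 1) → Fin (D + 1)) =
        Fin.cons c a ∘ Equiv.Perm.decomposeFin.symm (0, π) := by
      funext i
      refine Fin.cases ?_ (fun i => ?_) i <;> simp
    rw [h, hT.symm]
  trace k a b := by
    simp only [SpinChain.condition]
    rw [Finset.sum_comm]
    refine Finset.sum_congr rfl fun c _ => ?_
    rw [Finset.sum_comm]
    refine Finset.sum_congr rfl fun d _ => ?_
    rw [← Finset.mul_sum, ← hT.trace]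
    congr 1
    refine Finset.sum_congr rfl fun e _ => ?_
    have h : ∀ x y (f : Fin k → Fin (D + 1)),
        (Fin.cons x (Fin.cons y f : Fin (k + 1) → Fin (D + 1)) : Fin (k + 2) → Fin (D + 1)) =
        Fin.cons y (Fin.cons x f : Fin (k + 1) → Fin (D + 1)) ∘ Equiv.swap 0 1 := by
      intro x y f
      funext i
      refine Fin.cases ?_ (fun i => Fin.cases ?_ (fun i => ?_) i) i
      · simp
      · simp
      · rw [Function.comp_apply, Equiv.swap_apply_of_ne_of_ne (Fin.succ_ne_zero _)
          (b := 1) (fun h => Fin.succ_ne_zero i (Fin.succ_injective (k + 1) h))]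
        simp
    rw [h c e a, h d e b, hT.symm, hT.symm_right]

/-! ### The compact convex set of Bose-symmetric states -/

/-- The marginals of the Bose-symmetric states of the infinite chain. -/
def boseStates (D : ℕ) : Set (Marginals D) :=
  {T | IsBosePositive T ∧ T 0 ![] ![] = 1}

theorem convex_boseStates (D : ℕ) : Convex ℝ (boseStates D) := by
  rintro S ⟨hS, hS1⟩ T ⟨hT, hT1⟩ p q hp hq hpq
  refine ⟨(hS.smul hp).add (hT.smul hq), ?_⟩
  simp only [Pi.add_apply, Pi.smul_apply, hS1, hT1, ← add_smul, hpq, one_smul]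

theorem isClosed_posSemidef {n : Type*} [Fintype n] :
    IsClosed {M : n → n → ℂ | (Matrix.of M).PosSemidef} := by
  simp only [Matrix.posSemidef_iff_dotProduct_mulVec, Matrix.IsHermitian.ext_iff, Set.ofPred_and,
    Set.ofPred_forall]
  refine IsClosed.inter (isClosed_iInter fun i => isClosed_iInter fun j => ?_)
    (isClosed_iInter fun x => ?_)
  · exact isClosed_eq (by simp only [Matrix.of_apply]; fun_prop)
      (by simp only [Matrix.of_apply]; fun_prop)
  · refine isClosed_le continuous_const ?_
    simp only [dotProduct, Matrix.mulVec, Matrix.of_apply]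
    fun_prop

theorem isClosed_boseStates (D : ℕ) : IsClosed (boseStates D) := by
  have h : boseStates D = {T | ∀ k, (Matrix.of (T k)).PosSemidef} ∩
      {T | ∀ k (π : Equiv.Perm (Fin k)) a b, T k (a ∘ π) b = T k a b} ∩
      {T | ∀ k a b, ∑ c, T (k + 1) (Fin.cons c a) (Fin.cons c b) = T k a b} ∩
      {T | T 0 ![] ![] = 1} := by
    ext T
    exact ⟨fun h => ⟨⟨⟨h.1.psd, h.1.symm⟩, h.1.trace⟩, h.2⟩,
      fun h => ⟨⟨h.1.1.1, h.1.1.2, h.1.2⟩, h.2⟩⟩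
  rw [h]
  simp only [Set.ofPred_forall]
  refine (((isClosed_iInter fun k => ?_).inter ?_).inter ?_).inter ?_
  · exact isClosed_posSemidef.preimage (continuous_apply k :
      Continuous fun T : Marginals D => T k)
  · exact isClosed_iInter fun k => isClosed_iInter fun π => isClosed_iInter fun a =>
      isClosed_iInter fun b => isClosed_eq (by fun_prop) (by fun_prop)
  · exact isClosed_iInter fun k => isClosed_iInter fun a =>
      isClosed_iInter fun b => isClosed_eq (by fun_prop) (by fun_prop)
  · exact isClosed_eq (by fun_prop) (by fun_prop)

/-- By `norm_le` the states lie in a product of closed unit discs, compact by Tychonoff. -/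
theorem isCompact_boseStates (D : ℕ) : IsCompact (boseStates D) := by
  refine IsCompact.of_isClosed_subset
    (isCompact_univ_pi fun k => isCompact_univ_pi fun a => isCompact_univ_pi fun b =>
      isCompact_closedBall (0 : ℂ) 1) (isClosed_boseStates D) ?_
  rintro T ⟨hT, hT1⟩
  simp only [Set.mem_pi, Set.mem_univ, forall_true_left, mem_closedBall_zero_iff]
  intro k a b
  simpa [hT1] using hT.norm_le k a b

/-! ### Extreme states are product states -/

variable {D : ℕ}

/-- Rescaled to mass one, `S` and `R` are states with `T` as a convex combination, so extremality
identifies them with `T`. -/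
theorem IsBosePositive.eq_of_mem_extremePoints {S R T : Marginals D}
    (hT : T ∈ (boseStates D).extremePoints ℝ) (hS : IsBosePositive S) (hR : IsBosePositive R)
    (hSR : S + R = T) (k : ℕ) (a b : Fin k → Fin (D + 1)) :
    S k a b = S 0 ![] ![] * T k a b := by
  rw [mem_extremePoints_iff_left] at hT
  have hS0 := Complex.nonneg_iff.1 (hS.diag_nonneg 0 ![])
  have hR0 := Complex.nonneg_iff.1 (hR.diag_nonneg 0 ![])
  have hS1 : S 0 ![] ![] = ((S 0 ![] ![]).re : ℂ) := Complex.ext (by simp) (by simp [← hS0.2])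
  have hR1 : R 0 ![] ![] = ((R 0 ![] ![]).re : ℂ) := Complex.ext (by simp) (by simp [← hR0.2])
  have hsum : S 0 ![] ![] + R 0 ![] ![] = 1 := by rw [← hT.1.2, ← hSR]; rfl
  generalize (S 0 ![] ![]).re = p at *
  generalize (R 0 ![] ![]).re = q at *
  have hpq : p + q = 1 := by
    rw [hS1, hR1] at hsum
    exact_mod_cast hsum
  -- A summand of mass zero cannot be rescaled, but it vanishes by `norm_le`.
  rcases hS0.1.eq_or_lt with hp | hp
  · have h := hS.norm_le k a b
    rw [hS1, Complex.ofReal_re, ← hp] at h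
    rw [hS1, ← hp, norm_le_zero_iff.1 h]
    simp
  rcases hR0.1.eq_or_lt with hq | hq
  · have h := hR.norm_le k a b
    rw [hR1, Complex.ofReal_re, ← hq] at h
    have hp1 : p = 1 := by linarith
    rw [hS1, hp1, ← hSR]
    simp [norm_le_zero_iff.1 h]
  have h := hT.2 (p⁻¹ • S)
    ⟨hS.smul (inv_nonneg.2 hp.le), by
      simp only [Pi.smul_apply, hS1, Complex.real_smul]
      rw [← Complex.ofReal_mul, inv_mul_cancel₀ hp.ne', Complex.ofReal_one]⟩ (q⁻¹ • R)
    ⟨hR.smul (inv_nonneg.2 hq.le), by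
      simp only [Pi.smul_apply, hR1, Complex.real_smul]
      rw [← Complex.ofReal_mul, inv_mul_cancel₀ hq.ne', Complex.ofReal_one]⟩
    ⟨p, q, hp, hq, hpq, by rw [smul_inv_smul₀ hp.ne', smul_inv_smul₀ hq.ne', hSR]⟩
  have hST : S = p • T := by rw [← h, smul_inv_smul₀ hp.ne']
  rw [hS1, hST]
  simp

/-- The complement `Q` of the projection onto `w` is again a Hermitian projection, so `Q = Qᴴ * Q`.
-/
theorem posSemidef_one_sub_vecMulVec_self_star {n : Type*} [Fintype n] [DecidableEq n] (w : n → ℂ)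
    (hw : star w ⬝ᵥ w = 1) : (1 - Matrix.vecMulVec w (star w)).PosSemidef := by
  have hP : Matrix.vecMulVec w (star w) * Matrix.vecMulVec w (star w) =
      Matrix.vecMulVec w (star w) := by
    rw [Matrix.vecMulVec_mul_vecMulVec, hw]
    simp
  have hH : (Matrix.vecMulVec w (star w))ᴴ = Matrix.vecMulVec w (star w) :=
    (Matrix.posSemidef_vecMulVec_self_star w).isHermitian
  have h := Matrix.posSemidef_conjTranspose_mul_self (1 - Matrix.vecMulVec w (star w))
  rw [Matrix.conjTranspose_sub, Matrix.conjTranspose_one, hH, sub_mul, mul_sub, mul_sub, hP] at h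
  simpa using h

/-- Polarization over `ℂ`: a sesquilinear form is determined by its values on the diagonal. -/
theorem matrix_eq_zero_of_forall_sum_eq_zero {n : Type*} [Fintype n] [DecidableEq n] (G : Matrix n n ℂ)
    (h : ∀ w : n → ℂ, ∑ c, ∑ d, w c * star (w d) * G c d = 0) : G = 0 := by
  rw [← (Matrix.toEuclideanLin (𝕜 := ℂ) (m := n) (n := n)).map_eq_zero_iff,
    ← inner_map_self_eq_zero]
  intro x
  rw [← inner_conj_symm, map_eq_zero, ← h fun c => star (x c)]
  simp only [PiLp.inner_apply, RCLike.inner_apply, Matrix.toLpLin_apply, Matrix.mulVec,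
    dotProduct, Finset.sum_mul]
  refine Finset.sum_congr rfl fun c _ => Finset.sum_congr rfl fun d _ => ?_
  simp
  ring

/-- Conditioning on `|w⟩⟨w|` and on its complement decomposes `T`, so the first piece is a multiple
of `T`. This is the claimed factorization tested against rank-one projections, which suffice by
polarization. -/
theorem apply_cons_of_mem_extremePoints {T : Marginals D}
    (hT : T ∈ (boseStates D).extremePoints ℝ) (k : ℕ) (a b : Fin k → Fin (D + 1))
    (c d : Fin (D + 1)) :
    T (k + 1) (Fin.cons c a) (Fin.cons d b) = T 1 ![c] ![d] * T k a b := by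
  have hTpos : IsBosePositive T := hT.1.1
  suffices h : (Matrix.of fun c d => T (k + 1) (Fin.cons c a) (Fin.cons d b) -
      T 1 ![c] ![d] * T k a b) = 0 by
    exact sub_eq_zero.1 (congrFun (congrFun h c) d)
  have hunit : ∀ w : Fin (D + 1) → ℂ, star w ⬝ᵥ w = 1 →
      ∑ c, ∑ d, w c * star (w d) * (T (k + 1) (Fin.cons c a) (Fin.cons d b) -
        T 1 ![c] ![d] * T k a b) = 0 := by
    intro w hw
    have h := IsBosePositive.eq_of_mem_extremePoints hT
      (hTpos.condition (Matrix.posSemidef_vecMulVec_self_star w))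
      (hTpos.condition (posSemidef_one_sub_vecMulVec_self_star w hw))
      (by rw [← condition_add, add_sub_cancel, hTpos.condition_one]) k a b
    simp only [mul_sub, Finset.sum_sub_distrib, sub_eq_zero]
    refine h.trans ?_
    simp only [condition, Finset.sum_mul, Matrix.vecMulVec_apply, mul_assoc]
    rfl
  -- Homogeneity extends the identity from unit vectors to all `w`.
  refine matrix_eq_zero_of_forall_sum_eq_zero _ fun w => ?_
  by_cases hw : w = 0
  · simp [hw]
  have hpos : 0 < ∑ c, ‖w c‖ ^ 2 := by
    obtain ⟨j, hj⟩ := Function.ne_iff.1 hw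
    exact Finset.sum_pos' (fun _ _ => by positivity)
      ⟨j, Finset.mem_univ j, by have := norm_pos_iff.2 hj; positivity⟩
  set r := √(∑ c, ‖w c‖ ^ 2) with hr
  have hr0 : (r : ℂ) ≠ 0 := by exact_mod_cast (Real.sqrt_pos.2 hpos).ne'
  have hrr : (r : ℂ) * r = ∑ c, (‖w c‖ : ℂ) ^ 2 := by
    rw [← Complex.ofReal_mul, hr, Real.mul_self_sqrt hpos.le]
    push_cast
    rfl
  have h := hunit (fun c => w c / r) (by
    have h1 : ∀ c, star (w c / r) * (w c / r) = (‖w c‖ : ℂ) ^ 2 / (r * r) := fun c => by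
      rw [← Complex.conj_mul']
      simp
      field_simp
    simp only [dotProduct, Pi.star_apply, h1]
    rw [← Finset.sum_div, ← hrr, div_self (mul_ne_zero hr0 hr0)])
  have h2 : ∀ c d, w c * star (w d) = (r * r) * (w c / r * star (w d / r)) := fun c d => by
    simp
    field_simp
  simp only [h2, mul_assoc (r * r : ℂ), ← Finset.mul_sum, Matrix.of_apply, h, mul_zero]

/-- The marginals of the zero-entanglement state of the unit vector `v`. -/
def prodMarginals (v : Site D) : Marginals D :=
  fun _ a b => (∏ i, star (v (a i))) * ∏ i, v (b i)

theorem exists_eq_prodMarginals_of_mem_extremePoints {T : Marginals D}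
    (hT : T ∈ (boseStates D).extremePoints ℝ) :
    ∃ v : Site D, ‖v‖ = 1 ∧ T = prodMarginals v := by
  have hpos : IsBosePositive T := hT.1.1
  have hone : T 0 ![] ![] = 1 := hT.1.2
  set ρ : Fin (D + 1) → Fin (D + 1) → ℂ := fun c d => T 1 ![c] ![d] with hρ
  have hcons : ∀ k (a b : Fin k → Fin (D + 1)) c d,
      T (k + 1) (Fin.cons c a) (Fin.cons d b) = ρ c d * T k a b :=
    apply_cons_of_mem_extremePoints hT
  have htrace : ∑ c, ρ c c = 1 := by rw [← hone, ← hpos.trace]; rfl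
  -- Swapping the two sites in the row index only: all `2 × 2` minors of `ρ` vanish. Invariance
  -- under simultaneous permutation of rows and columns would not give this.
  have hswap : ∀ c d c' d', ρ c d * ρ c' d' = ρ c' d * ρ c d' := by
    intro c d c' d'
    have h := hpos.symm 2 (Equiv.swap 0 1) ![c, c'] ![d, d']
    have hs : ![c, c'] ∘ Equiv.swap 0 1 = ![c', c] := by
      funext i
      fin_cases i <;> simp
    rw [hs] at h
    exact ((hcons 1 ![c'] ![d'] c d).symm.trans h.symm).trans (hcons 1 ![c] ![d'] c' d)
  obtain ⟨e, he⟩ : ∃ e, ρ e e ≠ 0 := by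
    by_contra! h
    simp [h] at htrace
  obtain ⟨r, hr, hre⟩ : ∃ r : ℝ, 0 < r ∧ ρ e e = (r : ℂ) * r := by
    have h0 := Complex.nonneg_iff.1 (hpos.diag_nonneg 1 ![e])
    have h1 : ρ e e = ((ρ e e).re : ℂ) := Complex.ext (by simp) (by simpa using h0.2.symm)
    have h2 : 0 < (ρ e e).re := h0.1.lt_of_ne fun h => he (by rw [h1]; exact_mod_cast h.symm)
    refine ⟨√(ρ e e).re, Real.sqrt_pos.2 h2, ?_⟩
    rw [← Complex.ofReal_mul, Real.mul_self_sqrt h2.le, ← h1]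
  have hr0 : (r : ℂ) ≠ 0 := by exact_mod_cast hr.ne'
  -- A rank-one matrix is recovered from one row with nonzero diagonal entry; `r` is the square root
  -- of that entry.
  let v : Site D := WithLp.toLp 2 fun d => ρ e d / r
  have hv : ∀ c d, ρ c d = star (v c) * v d := by
    intro c d
    have h1 : star (ρ e c) = ρ c e := hpos.star_apply 1 ![e] ![c]
    have h2 : star (v c) = ρ c e / r := by simp [v, ← h1]
    rw [h2]
    change ρ c d = ρ c e / r * (ρ e d / r)
    rw [div_mul_div_comm, hswap c e e d, hre]
    field_simp
  refine ⟨v, ?_, ?_⟩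
  · have h : ((‖v‖ ^ 2 : ℝ) : ℂ) = 1 := by
      rw [EuclideanSpace.norm_sq_eq, ← htrace]
      push_cast
      exact Finset.sum_congr rfl fun c _ => by rw [hv, ← Complex.conj_mul']; rfl
    have h' : ‖v‖ ^ 2 = 1 := by exact_mod_cast h
    exact (pow_eq_one_iff_of_nonneg (norm_nonneg v) two_ne_zero).1 h'
  · funext k
    induction k with
    | zero =>
      funext a b
      rw [Subsingleton.elim a ![], Subsingleton.elim b ![], hone]
      simp [prodMarginals]
    | succ k ih =>
      funext a b
      rw [← Fin.cons_self_tail a, ← Fin.cons_self_tail b]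
      refine (hcons k _ _ _ _).trans ?_
      rw [hv, ih]
      simp only [prodMarginals, Fin.prod_univ_succ, Fin.cons_zero, Fin.cons_succ]
      ring

/-! ### Matrix units and the marginals of a thermodynamic limit -/

/-- The matrix unit `|a⟩⟨b|` on `k` sites. -/
def matUnit {k : ℕ} (a b : Fin k → Fin (D + 1)) : Module.End ℂ (H D k) where
  toFun Φ := EuclideanSpace.single a (Φ b)
  map_add' Φ Ψ := by
    ext σ
    simp only [PiLp.add_apply, PiLp.single_apply]
    split_ifs <;> simp
  map_smul' c Φ := by ext; simp

theorem matUnit_apply {k : ℕ} (a b : Fin k → Fin (D + 1)) (Φ : H D k) (σ : Fin k → Fin (D + 1)) :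
    matUnit a b Φ σ = if σ = a then Φ b else 0 := by
  simp [matUnit]

theorem eq_sum_matUnit {k : ℕ} (O : Module.End ℂ (H D k)) :
    O = ∑ a, ∑ b, O (EuclideanSpace.single b 1) a • matUnit a b := by
  refine (EuclideanSpace.basisFun _ ℂ).toBasis.ext fun c => ?_
  ext σ
  simp [LinearMap.sum_apply, matUnit_apply]

theorem inner_embed_matUnit {k n : ℕ} (a b : Fin k → Fin (D + 1)) (Φ Ψ : H D (k + n)) :
    inner ℂ Φ (embed D k (k + n) (Nat.le_add_right k n) (matUnit a b) Ψ) =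
      ∑ c : Fin n → Fin (D + 1), star (Φ (Fin.append a c)) * Ψ (Fin.append b c) := by
  simp only [PiLp.inner_apply, RCLike.inner_apply]
  rw [← (Fin.appendEquiv k n).sum_comp, Fintype.sum_prod_type, Finset.sum_comm]
  refine Finset.sum_congr rfl fun c _ => ?_
  have h : ∀ x : Fin k → Fin (D + 1),
      (embed D k (k + n) (Nat.le_add_right k n) (matUnit a b) Ψ) (Fin.append x c) =
        if x = a then Ψ (Fin.append b c) else 0 := by
    intro x
    have hr : (fun i => Fin.append x c (Fin.castLE (Nat.le_add_right k n) i)) = x := by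
      funext i
      exact Fin.append_left x c i
    have ho : overwrite b (Fin.append x c) = Fin.append b c := by
      funext i
      refine Fin.addCases (fun j => ?_) (fun j => ?_) i <;> simp [overwrite]
    change (matUnit a b (slice k Ψ (Fin.append x c)))
      (fun i => Fin.append x c (Fin.castLE (Nat.le_add_right k n) i)) = _
    rw [hr, matUnit_apply, ← ho]
    rfl
  simp only [Fin.appendEquiv, Equiv.coe_fn_mk, h, ite_mul, zero_mul, Finset.sum_ite_eq',
    Finset.mem_univ, if_true]
  rw [mul_comm]
  rfl

theorem inner_eq_sum_append {k n : ℕ} (Φ Ψ : H D (k + n)) :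
    inner ℂ Φ Ψ = ∑ a : Fin k → Fin (D + 1), ∑ c : Fin n → Fin (D + 1),
      star (Φ (Fin.append a c)) * Ψ (Fin.append a c) := by
  simp only [PiLp.inner_apply, RCLike.inner_apply]
  rw [← (Fin.appendEquiv k n).sum_comp, Fintype.sum_prod_type]
  refine Finset.sum_congr rfl fun a _ => Finset.sum_congr rfl fun c _ => ?_
  rw [mul_comm]
  rfl

theorem embed_matUnit_succ {k : ℕ} (a b : Fin k → Fin (D + 1)) :
    embed D k (k + 1) (Nat.le_succ k) (matUnit a b) =
      ∑ c : Fin (D + 1), matUnit (Fin.snoc a c) (Fin.snoc b c) := by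
  apply LinearMap.ext
  intro Φ
  ext σ
  rw [LinearMap.sum_apply, WithLp.ofLp_sum, Finset.sum_apply]
  simp only [matUnit_apply]
  have hσ : ∀ c, (σ = Fin.snoc a c) ↔ (c = σ (Fin.last k) ∧ Fin.init σ = a) := by
    intro c
    constructor
    · rintro rfl
      exact ⟨(Fin.snoc_last (α := fun _ => Fin (D + 1)) c a).symm,
        Fin.init_snoc (α := fun _ => Fin (D + 1)) c a⟩
    · rintro ⟨rfl, rfl⟩
      exact (Fin.snoc_init_self σ).symm
  have ho : overwrite b σ = Fin.snoc b (σ (Fin.last k)) := by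
    funext i
    refine Fin.lastCases ?_ (fun j => ?_) i <;> simp [overwrite]
  change (matUnit a b (slice k Φ σ)) (Fin.init σ) = _
  rw [matUnit_apply]
  simp only [hσ, ite_and, Finset.sum_ite_eq', Finset.mem_univ, if_true, slice, ho]

/-- The marginals of a functional on the finitely supported operators. -/
def marginals (ψ : LocalOp D →ₗ[ℂ] ℂ) : Marginals D :=
  fun k a b => ψ (toLocalOp D k (matUnit a b))

/-- Reduced matrices of a symmetric vector are sums of rank-one positive matrices over the remaining
sites, and permuting the first `k` sites leaves the vector unchanged. Both properties survive the
limit. -/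
theorem marginals_mem_boseStates {ψ : LocalOp D →ₗ[ℂ] ℂ} (hψ : ψ ∈ thermoStates D) :
    marginals ψ ∈ boseStates D := by
  obtain ⟨φ, hφ, hlim⟩ := hψ
  choose Φ hΦs hΦ0 hφΦ using hφ
  have hlim' : ∀ k a b, Tendsto (fun n => (∑ c : Fin n → Fin (D + 1),
      star (Φ (k + n) (Fin.append a c)) * Φ (k + n) (Fin.append b c)) /
        inner ℂ (Φ (k + n)) (Φ (k + n))) atTop (𝓝 (marginals ψ k a b)) := by
    intro k a b
    refine (hlim k (matUnit a b)).congr fun n => ?_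
    rw [hφΦ, ← inner_embed_matUnit]
    rfl
  have hsymm : ∀ k (π : Equiv.Perm (Fin k)) a b,
      marginals ψ k (a ∘ π) b = marginals ψ k a b := by
    intro k π a b
    refine tendsto_nhds_unique (hlim' k (a ∘ π) b) ((hlim' k a b).congr fun n => ?_)
    congr 1
    refine Finset.sum_congr rfl fun c _ => ?_
    have h : Fin.append (a ∘ π) c =
        Fin.append a c ∘ finSumFinEquiv.permCongr (Equiv.sumCongr π (Equiv.refl (Fin n))) := by
      funext i
      refine Fin.addCases (fun j => ?_) (fun j => ?_) i <;> simp [Equiv.permCongr_apply]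
    rw [h, hΦs (k + n)]
  have hpsd : ∀ k, (Matrix.of (marginals ψ k)).PosSemidef := by
    intro k
    refine isClosed_posSemidef.mem_of_tendsto
      (tendsto_pi_nhds.2 fun a => tendsto_pi_nhds.2 fun b => hlim' k a b)
      (Eventually.of_forall fun n => ?_)
    have h : (Matrix.of fun a b => (∑ c : Fin n → Fin (D + 1),
        star (Φ (k + n) (Fin.append a c)) * Φ (k + n) (Fin.append b c)) /
          inner ℂ (Φ (k + n)) (Φ (k + n))) =
        (inner ℂ (Φ (k + n)) (Φ (k + n)))⁻¹ • ∑ c : Fin n → Fin (D + 1),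
          Matrix.vecMulVec (star fun a => Φ (k + n) (Fin.append a c))
            (fun a => Φ (k + n) (Fin.append a c)) := by
      ext a b
      simp [Matrix.sum_apply, Matrix.vecMulVec_apply, div_eq_inv_mul]
    have h0 : (0 : ℂ) ≤ (inner ℂ (Φ (k + n)) (Φ (k + n)))⁻¹ := by
      rw [inner_self_eq_norm_sq_to_K, ← RCLike.ofReal_pow]
      exact inv_nonneg.2 (Complex.zero_le_real.2 (sq_nonneg _))
    change Matrix.PosSemidef (Matrix.of _)
    rw [h]
    exact (Matrix.posSemidef_sum _ fun c _ => Matrix.posSemidef_vecMulVec_star_self _).smul h0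
  have hsymm' : ∀ k (π : Equiv.Perm (Fin k)) a b,
      marginals ψ k a (b ∘ π) = marginals ψ k a b := by
    intro k π a b
    have hstar : ∀ a b, star (marginals ψ k a b) = marginals ψ k b a :=
      fun a b => (hpsd k).isHermitian.apply b a
    rw [← hstar, hsymm, hstar]
  refine ⟨⟨hpsd, hsymm, ?_⟩, ?_⟩
  · intro k a b
    have h : toLocalOp D k (matUnit a b) =
        ∑ c : Fin (D + 1), toLocalOp D (k + 1) (matUnit (Fin.snoc a c) (Fin.snoc b c)) := by
      rw [← map_sum, ← embed_matUnit_succ]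
      exact Module.DirectLimit.of_f.symm
    simp only [marginals]
    rw [h, map_sum]
    refine Finset.sum_congr rfl fun c _ => ?_
    -- The embedding adds a site at the end, the trace condition at the front; a cyclic rotation
    -- relates them.
    have hs : ∀ x : Fin k → Fin (D + 1), (Fin.snoc x c : Fin (k + 1) → Fin (D + 1)) =
        (Fin.cons c x : Fin (k + 1) → Fin (D + 1)) ∘ finRotate (k + 1) :=
      fun x => Fin.snoc_eq_cons_rotate x c
    rw [hs, hs]
    exact ((hsymm _ _ _ _).trans (hsymm' _ _ _ _)).symm
  · refine tendsto_nhds_unique (hlim' 0 ![] ![]) (tendsto_const_nhds.congr fun n => ?_)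
    have h := inner_eq_sum_append (k := 0) (Φ (0 + n)) (Φ (0 + n))
    rw [Fintype.sum_subsingleton _ ![]] at h
    rw [← h, div_self (inner_self_ne_zero.2 (hΦ0 _))]

theorem inner_prodVec {k : ℕ} (v w : Site D) :
    inner ℂ (prodVec v k) (prodVec w k) = inner ℂ v w ^ k := by
  simp only [PiLp.inner_apply, RCLike.inner_apply, prodVec, map_prod, ← Finset.prod_mul_distrib]
  rw [← Fin.prod_const, Finset.prod_univ_sum, Fintype.piFinset_univ]

theorem zeroEntState_mk_toLocalOp {v : Site D} (hv : v ≠ 0) (k : ℕ) (O : Module.End ℂ (H D k)) :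
    zeroEntState (Projectivization.mk ℂ v hv : CP D) (toLocalOp D k O) =
      vectorState (prodVec v k) O :=
  Module.DirectLimit.lift_of (fun N => vectorState (prodVec v N))
    (fun k N h O => vectorState_prodVec_embed hv k N h O) O

theorem marginals_zeroEntState {v : Site D} (hv : v ≠ 0) (hv1 : ‖v‖ = 1) :
    marginals (zeroEntState (Projectivization.mk ℂ v hv : CP D)) = prodMarginals v := by
  funext k a b
  rw [marginals, zeroEntState_mk_toLocalOp]
  change inner ℂ (prodVec v k) (matUnit a b (prodVec v k)) /
    inner ℂ (prodVec v k) (prodVec v k) = _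
  rw [inner_prodVec, inner_self_eq_norm_sq_to_K, hv1]
  simp [PiLp.inner_apply, matUnit_apply, prodVec, prodMarginals, mul_comm]

theorem ext_marginals {ψ ψ' : LocalOp D →ₗ[ℂ] ℂ} (h : marginals ψ = marginals ψ') : ψ = ψ' := by
  refine Module.DirectLimit.hom_ext fun k => LinearMap.ext fun O => ?_
  rw [eq_sum_matUnit O]
  simp only [map_sum, map_smul, LinearMap.comp_apply]
  refine Finset.sum_congr rfl fun a _ => Finset.sum_congr rfl fun b _ => ?_
  congr 1
  exact congrFun (congrFun (congrFun h k) a) b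

/-! ### Continuity in the point and compactness of `ℂP^D` -/

theorem continuous_vectorState_prodVec (k : ℕ) (O : Module.End ℂ (H D k)) :
    Continuous fun v : {v : Site D // v ≠ 0} => vectorState (prodVec v.1 k) O := by
  have h1 : Continuous fun v : {v : Site D // v ≠ 0} => prodVec v.1 k := by
    unfold prodVec
    fun_prop
  have h2 : Continuous O := O.continuous_of_finiteDimensional
  exact (h1.inner (h2.comp h1)).div (h1.inner h1) fun v =>
    inner_self_ne_zero.2 (prodVec_ne_zero v.2 k)

theorem isQuotientMap_projectivization_mk (D : ℕ) :
    IsQuotientMap fun v : {v : Site D // v ≠ 0} => (Projectivization.mk ℂ v.1 v.2 : CP D) :=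
  isQuotientMap_quot_mk

theorem continuous_zeroEntState (O : LocalOp D) :
    Continuous fun p : CP D => zeroEntState p O := by
  obtain ⟨k, O, rfl⟩ := Module.DirectLimit.exists_of O
  refine (isQuotientMap_projectivization_mk D).continuous_iff.2 ?_
  exact (continuous_vectorState_prodVec k O).congr fun v =>
    (zeroEntState_mk_toLocalOp v.2 k O).symm

/-- The unit vectors of the local space. -/
abbrev UnitSphere (D : ℕ) : Type := Metric.sphere (0 : Site D) 1

/-- The point of `ℂP^D` given by a unit vector. -/
def ofSphere (v : UnitSphere D) : CP D :=
  Projectivization.mk ℂ v.1 (ne_zero_of_mem_unit_sphere v)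

theorem continuous_ofSphere : Continuous (ofSphere (D := D)) :=
  (isQuotientMap_projectivization_mk D).continuous.comp
    (continuous_subtype_val.subtype_mk fun v => ne_zero_of_mem_unit_sphere v)

theorem ofSphere_surjective : Function.Surjective (ofSphere (D := D)) := by
  intro p
  induction p using Projectivization.ind with
  | h v hv =>
    have hv' : ‖v‖ ≠ 0 := norm_ne_zero_iff.2 hv
    refine ⟨⟨(‖v‖ : ℂ)⁻¹ • v, by simp [norm_smul, hv']⟩, ?_⟩
    rw [ofSphere, Projectivization.mk_eq_mk_iff']
    exact ⟨(‖v‖ : ℂ)⁻¹, rfl⟩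

instance : CompactSpace (CP D) :=
  ofSphere_surjective.compactSpace continuous_ofSphere

theorem marginals_zeroEntState_ofSphere (v : UnitSphere D) :
    marginals (zeroEntState (ofSphere v)) = prodMarginals v.1 :=
  marginals_zeroEntState _ (norm_eq_of_mem_sphere v)

theorem integrable_of_continuous_of_compactSpace {X E : Type*} [TopologicalSpace X]
    [CompactSpace X] [MeasurableSpace X] [BorelSpace X] [NormedAddCommGroup E]
    [SecondCountableTopology E] {μ : Measure X} [IsFiniteMeasure μ] {f : X → E}
    (hf : Continuous f) : Integrable f μ := by
  obtain ⟨C, hC⟩ := (isCompact_range hf).isBounded.exists_norm_le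
  exact Integrable.of_bound hf.aestronglyMeasurable C
    (Eventually.of_forall fun x => hC _ (Set.mem_range_self x))

theorem integrable_zeroEntState (μ : Measure (CP D)) [IsFiniteMeasure μ] (O : LocalOp D) :
    Integrable (fun p => zeroEntState p O) μ :=
  integrable_of_continuous_of_compactSpace (continuous_zeroEntState O)

/-! ### Mixtures and the integral representation -/

/-- The mixture of the zero-entanglement states with weight `μ`. -/
def mixture (μ : Measure (CP D)) [IsFiniteMeasure μ] : LocalOp D →ₗ[ℂ] ℂ where
  toFun O := ∫ p, zeroEntState p O ∂μ
  map_add' O O' := by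
    simp only [map_add]
    exact integral_add (integrable_zeroEntState μ O) (integrable_zeroEntState μ O')
  map_smul' c O := by
    simp only [map_smul, RingHom.id_apply]
    exact integral_smul c _

theorem represents_mixture (μ : Measure (CP D)) [IsFiniteMeasure μ] :
    Represents μ (mixture μ) :=
  fun O => ⟨integrable_zeroEntState μ O, rfl⟩

/-- The marginals of the mixtures of the zero-entanglement states of unit vectors. -/
def mixtureMarginals (ν : ProbabilityMeasure (UnitSphere D)) : Marginals D :=
  fun k a b => ∫ v, prodMarginals v.1 k a b ∂(ν : Measure (UnitSphere D))

theorem continuous_prodMarginals (k : ℕ) (a b : Fin k → Fin (D + 1)) :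
    Continuous fun v : UnitSphere D => prodMarginals v.1 k a b := by
  unfold prodMarginals
  fun_prop

/-- Each marginal integrates a bounded continuous function, as weak convergence of measures
requires. -/
theorem continuous_mixtureMarginals : Continuous (mixtureMarginals (D := D)) := by
  refine continuous_pi fun k => continuous_pi fun a => continuous_pi fun b => ?_
  refine continuous_iff_continuousAt.2 fun ν => ?_
  exact (ProbabilityMeasure.tendsto_iff_forall_integral_rclike_tendsto ℂ).1 tendsto_id
    (BoundedContinuousFunction.mkOfCompact ⟨_, continuous_prodMarginals k a b⟩)

theorem convex_range_mixtureMarginals : Convex ℝ (Set.range (mixtureMarginals (D := D))) := by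
  rintro _ ⟨ν₁, rfl⟩ _ ⟨ν₂, rfl⟩ p q hp hq hpq
  have hprob : IsProbabilityMeasure
      (ENNReal.ofReal p • (ν₁ : Measure (UnitSphere D)) +
        ENNReal.ofReal q • (ν₂ : Measure (UnitSphere D))) :=
    ⟨by simp [← ENNReal.ofReal_add hp hq, hpq]⟩
  refine ⟨⟨_, hprob⟩, ?_⟩
  funext k a b
  have hint : ∀ ν : ProbabilityMeasure (UnitSphere D),
      Integrable (fun v => prodMarginals v.1 k a b) (ν : Measure (UnitSphere D)) := fun ν =>
    integrable_of_continuous_of_compactSpace (continuous_prodMarginals k a b)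
  simp only [mixtureMarginals, ProbabilityMeasure.coe_mk]
  rw [integral_add_measure ((hint ν₁).smul_measure ENNReal.ofReal_ne_top)
    ((hint ν₂).smul_measure ENNReal.ofReal_ne_top), integral_smul_measure, integral_smul_measure,
    ENNReal.toReal_ofReal hp, ENNReal.toReal_ofReal hq]
  rfl

theorem prodMarginals_mem_range_mixtureMarginals {v : Site D} (hv : ‖v‖ = 1) :
    prodMarginals v ∈ Set.range (mixtureMarginals (D := D)) := by
  refine ⟨⟨Measure.dirac ⟨v, by simpa using hv⟩, inferInstance⟩, ?_⟩
  funext k a b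
  simp only [mixtureMarginals, ProbabilityMeasure.coe_mk]
  rw [integral_dirac]

/-- Krein–Milman: the range is convex, closed as a continuous image of a compact space, and contains
every extreme state. -/
theorem boseStates_subset_range_mixtureMarginals :
    boseStates D ⊆ Set.range (mixtureMarginals (D := D)) := by
  rw [← closure_convexHull_extremePoints (isCompact_boseStates D) (convex_boseStates D)]
  refine closure_minimal (convexHull_min ?_ convex_range_mixtureMarginals)
    (isCompact_range continuous_mixtureMarginals).isClosed
  intro T hT
  obtain ⟨v, hv, rfl⟩ := exists_eq_prodMarginals_of_mem_extremePoints hT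
  exact prodMarginals_mem_range_mixtureMarginals hv

/-- The representing measure is the image on `ℂP^D` of one on the unit sphere. -/
theorem exists_represents {ψ : LocalOp D →ₗ[ℂ] ℂ} (hψ : ψ ∈ thermoStates D) :
    ∃ μ : Measure (CP D), IsProbabilityMeasure μ ∧ Represents μ ψ := by
  obtain ⟨ν, hν⟩ := boseStates_subset_range_mixtureMarginals (marginals_mem_boseStates hψ)
  have hm : Measurable (ofSphere (D := D)) := continuous_ofSphere.measurable
  have hprob : IsProbabilityMeasure
      (Measure.map ofSphere (ν : Measure (UnitSphere D))) :=
    Measure.isProbabilityMeasure_map hm.aemeasurable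
  refine ⟨_, hprob, ?_⟩
  convert represents_mixture (Measure.map ofSphere (ν : Measure (UnitSphere D)))
  refine ext_marginals ?_
  rw [← hν]
  funext k a b
  change _ = ∫ p, zeroEntState p (toLocalOp D k (matUnit a b)) ∂_
  rw [integral_map hm.aemeasurable (continuous_zeroEntState _).aestronglyMeasurable]
  refine integral_congr_ae (Eventually.of_forall fun v => ?_)
  exact (congrFun (congrFun (congrFun (marginals_zeroEntState_ofSphere v) k) a) b).symm

/-! ### Diagonal extraction of an approximating sequence -/

theorem nonempty_pureSymStates (D N : ℕ) : (pureSymStates D N).Nonempty := by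
  have h : (EuclideanSpace.single 0 1 : Site D) ≠ 0 := by simp
  exact ⟨_, _, prodVec_mem_symSubspace (EuclideanSpace.single 0 1) N, prodVec_ne_zero h N, rfl⟩

/-- The functional `φ` on `N` sites and the functional `ψ` agree up to `1 / (m + 1)` on the matrix
units on at most `m` sites. -/
def IsApprox {N : ℕ} (m : ℕ) (φ : Module.End ℂ (H D N) →ₗ[ℂ] ℂ) (ψ : LocalOp D →ₗ[ℂ] ℂ) : Prop :=
  ∀ k ≤ m, ∀ (h : k ≤ N) (a b : Fin k → Fin (D + 1)),
    ‖φ (embed D k N h (matUnit a b)) - marginals ψ k a b‖ < 1 / (m + 1 : ℝ)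

theorem isLocalLimit_of_tendsto_matUnit {φ : ∀ N, Module.End ℂ (H D N) →ₗ[ℂ] ℂ}
    {ψ : LocalOp D →ₗ[ℂ] ℂ}
    (h : ∀ k (a b : Fin k → Fin (D + 1)), Tendsto
      (fun n => φ (k + n) (embed D k (k + n) (Nat.le_add_right k n) (matUnit a b))) atTop
      (𝓝 (marginals ψ k a b))) :
    IsLocalLimit φ ψ := by
  intro k O
  rw [eq_sum_matUnit O]
  simp only [map_sum, map_smul]
  exact tendsto_finsetSum _ fun a _ => tendsto_finsetSum _ fun b _ => (h k a b).const_smul _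

theorem mem_thermoStates_of_isApprox {ψ : LocalOp D →ₗ[ℂ] ℂ}
    (h : ∀ m : ℕ, ∀ᶠ N in atTop, ∃ φ ∈ pureSymStates D N, IsApprox m φ ψ) :
    ψ ∈ thermoStates D := by
  classical
  let A : ℕ → ℕ → Prop := fun N m => ∃ φ ∈ pureSymStates D N, IsApprox m φ ψ
  -- The best precision reachable on `N` sites, capped at `N` so that a maximum exists; it tends to
  -- infinity.
  let M : ℕ → ℕ := fun N => Nat.findGreatest (A N) N
  have hM : ∀ m, ∀ᶠ N in atTop, m ≤ M N ∧ A N (M N) := by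
    intro m
    filter_upwards [h m, eventually_ge_atTop m] with N hN hmN
    exact ⟨Nat.le_findGreatest hmN hN, Nat.findGreatest_spec hmN hN⟩
  have hφ : ∀ N, ∃ φ ∈ pureSymStates D N, A N (M N) → IsApprox (M N) φ ψ := by
    intro N
    by_cases hA : A N (M N)
    · obtain ⟨φ, hφ, hφψ⟩ := hA
      exact ⟨φ, hφ, fun _ => hφψ⟩
    -- This occurs for finitely many `N` only, where any state will do.
    · obtain ⟨φ, hφ⟩ := nonempty_pureSymStates D N
      exact ⟨φ, hφ, fun h => absurd h hA⟩
  choose φ hφ hφψ using hφ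
  refine ⟨φ, hφ, isLocalLimit_of_tendsto_matUnit fun k a b => ?_⟩
  refine Metric.tendsto_atTop'.2 fun ε hε => ?_
  obtain ⟨m, hm⟩ := exists_nat_one_div_lt hε
  obtain ⟨N₀, hN₀⟩ := eventually_atTop.1 (hM (max m k))
  refine ⟨N₀, fun n hn => ?_⟩
  obtain ⟨h1, h2⟩ := hN₀ (k + n) (by omega)
  rw [dist_eq_norm]
  refine (hφψ _ h2 k ((le_max_right _ _).trans h1) (Nat.le_add_right k n) a b).trans
    (lt_of_le_of_lt ?_ hm)
  have h3 : (m : ℝ) ≤ M (k + n) := by exact_mod_cast (le_max_left _ _).trans h1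
  gcongr

/-! ### Superpositions of product vectors -/

theorem inner_prodVec_embed_matUnit {k n : ℕ} (v w : Site D) (a b : Fin k → Fin (D + 1)) :
    inner ℂ (prodVec v (k + n))
      (embed D k (k + n) (Nat.le_add_right k n) (matUnit a b) (prodVec w (k + n))) =
      (∏ i, star (v (a i))) * (∏ i, w (b i)) * inner ℂ v w ^ n := by
  rw [inner_embed_matUnit, ← inner_prodVec]
  simp only [PiLp.inner_apply, RCLike.inner_apply, prodVec, Fin.prod_univ_add, Fin.append_left,
    Fin.append_right, Finset.mul_sum]
  refine Finset.sum_congr rfl fun c _ => ?_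
  simp
  ring

/-- Equality in Cauchy–Schwarz would make the vectors collinear. -/
theorem norm_inner_lt_one_of_ofSphere_ne {v w : UnitSphere D} (h : ofSphere v ≠ ofSphere w) :
    ‖inner ℂ v.1 w.1‖ < 1 := by
  have hv : ‖v.1‖ = 1 := norm_eq_of_mem_sphere v
  have hw : ‖w.1‖ = 1 := norm_eq_of_mem_sphere w
  refine lt_of_le_of_ne (by simpa [hv, hw] using norm_inner_le_norm (𝕜 := ℂ) v.1 w.1) fun he => h ?_
  obtain ⟨r, -, hr⟩ := (norm_inner_eq_norm_iff (𝕜 := ℂ) (ne_zero_of_mem_unit_sphere v)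
    (ne_zero_of_mem_unit_sphere w)).1 (by rw [he, hv, hw, one_mul])
  exact ((Projectivization.mk_eq_mk_iff' _ _ _ _ _).2 ⟨r, hr.symm⟩).symm

theorem tendsto_sum_mul_inner_pow {ι : Type*} [Fintype ι] {v : ι → UnitSphere D}
    (hv : Function.Injective fun i => ofSphere (v i)) (K : ι → ι → ℂ) :
    Tendsto (fun n : ℕ => ∑ i, ∑ j, K i j * inner ℂ (v i).1 (v j).1 ^ n) atTop
      (𝓝 (∑ i, K i i)) := by
  classical
  have h : ∀ i, K i i = ∑ j, K i j * if i = j then 1 else 0 := fun i => by simp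
  simp_rw [h]
  refine tendsto_finsetSum _ fun i _ => tendsto_finsetSum _ fun j _ =>
    Tendsto.const_mul _ ?_
  split_ifs with hij
  · subst hij
    have h1 : inner ℂ (v i).1 (v i).1 = (1 : ℂ) := by
      rw [inner_self_eq_norm_sq_to_K, norm_eq_of_mem_sphere]
      simp
    rw [h1]
    exact tendsto_const_nhds.congr fun n : ℕ => (one_pow (M := ℂ) n).symm
  · exact tendsto_pow_atTop_nhds_zero_of_norm_lt_one
      (norm_inner_lt_one_of_ofSphere_ne fun he => hij (hv he))

/-- The superposition `∑ √(w i) v i ⊗ ⋯ ⊗ v i`. -/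
def superposition {ι : Type*} [Fintype ι] (w : ι → ℝ) (v : ι → UnitSphere D) (N : ℕ) : H D N :=
  ∑ i, (√(w i) : ℂ) • prodVec (v i).1 N

section superposition

variable {ι : Type*} [Fintype ι] {w : ι → ℝ} {v : ι → UnitSphere D}

theorem inner_superposition (N : ℕ) (O : Module.End ℂ (H D N)) :
    inner ℂ (superposition w v N) (O (superposition w v N)) =
      ∑ i, ∑ j, (√(w i) : ℂ) * √(w j) * inner ℂ (prodVec (v i).1 N) (O (prodVec (v j).1 N)) := by
  simp only [superposition, map_sum, map_smul, sum_inner, inner_sum, inner_smul_left,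
    inner_smul_right, Complex.conj_ofReal, mul_assoc, Finset.mul_sum]
  rw [Finset.sum_comm]
  exact Finset.sum_congr rfl fun i _ => Finset.sum_congr rfl fun j _ => by ring

theorem tendsto_inner_superposition_self (hv : Function.Injective fun i => ofSphere (v i))
    (hw : ∀ i, 0 ≤ w i) (hw1 : ∑ i, w i = 1) :
    Tendsto (fun N => inner ℂ (superposition w v N) (superposition w v N)) atTop (𝓝 (1 : ℂ)) := by
  have h := tendsto_sum_mul_inner_pow hv fun i j => (√(w i) : ℂ) * √(w j)
  have h1 : ∑ i, (√(w i) : ℂ) * √(w i) = 1 := by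
    rw [← Complex.ofReal_one, ← hw1, Complex.ofReal_sum]
    exact Finset.sum_congr rfl fun i _ => by
      rw [← Complex.ofReal_mul, Real.mul_self_sqrt (hw i)]
  rw [h1] at h
  refine h.congr fun N => ?_
  have h2 := inner_superposition (w := w) (v := v) N LinearMap.id
  simp only [LinearMap.id_apply, inner_prodVec] at h2
  exact h2.symm

/-- The first `k` sites contribute fixed coefficients and the other `n` the power `⟨v i, v j⟩ ^ n`,
so only `i = j` survives; the norm tends to one. -/
theorem tendsto_vectorState_superposition (hv : Function.Injective fun i => ofSphere (v i))
    (hw : ∀ i, 0 ≤ w i) (hw1 : ∑ i, w i = 1) (k : ℕ) (a b : Fin k → Fin (D + 1)) :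
    Tendsto (fun n => vectorState (superposition w v (k + n))
      (embed D k (k + n) (Nat.le_add_right k n) (matUnit a b))) atTop
      (𝓝 (∑ i, w i * prodMarginals (v i).1 k a b)) := by
  have h1 := (tendsto_inner_superposition_self hv hw hw1).comp (tendsto_add_atTop_nat k)
  have h2 := tendsto_sum_mul_inner_pow hv fun i j => (√(w i) : ℂ) * √(w j) *
    ((∏ l, star ((v i).1 (a l))) * ∏ l, (v j).1 (b l))
  have h3 := h2.div h1 one_ne_zero
  rw [div_one] at h3
  have h4 : ∑ i, (w i : ℂ) * prodMarginals (v i).1 k a b = ∑ i, (√(w i) : ℂ) * √(w i) *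
      ((∏ l, star ((v i).1 (a l))) * ∏ l, (v i).1 (b l)) :=
    Finset.sum_congr rfl fun i _ => by
      rw [← Complex.ofReal_mul, Real.mul_self_sqrt (hw i)]
      rfl
  rw [h4]
  refine h3.congr fun n => ?_
  have h5 := inner_superposition (w := w) (v := v) (k + n)
    (embed D k (k + n) (Nat.le_add_right k n) (matUnit a b))
  simp only [inner_prodVec_embed_matUnit, ← mul_assoc] at h5
  simp only [Pi.div_apply, Function.comp_apply, ← mul_assoc]
  rw [← h5, Nat.add_comm n k]
  rfl

theorem superposition_mem_symSubspace (N : ℕ) : superposition w v N ∈ symSubspace D N :=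
  Submodule.sum_mem _ fun i _ => Submodule.smul_mem _ _ (prodVec_mem_symSubspace (v i).1 N)

end superposition

/-! ### Finite mixtures and the converse -/

theorem exists_finite_mixture_approx (μ : Measure (CP D)) [IsProbabilityMeasure μ] (m : ℕ)
    {ε : ℝ} (hε : 0 < ε) :
    ∃ (ι : Type) (_ : Fintype ι) (w : ι → ℝ) (v : ι → UnitSphere D),
      (Function.Injective fun i => ofSphere (v i)) ∧ (∀ i, 0 ≤ w i) ∧ ∑ i, w i = 1 ∧
      ∀ k ≤ m, ∀ a b : Fin k → Fin (D + 1),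
        ‖∑ i, w i * prodMarginals (v i).1 k a b - marginals (mixture μ) k a b‖ < ε := by
  let F := Σ k : Fin (m + 1), (Fin k → Fin (D + 1)) × (Fin k → Fin (D + 1))
  let f : CP D → F → ℂ := fun p x => marginals (zeroEntState p) x.1 x.2.1 x.2.2
  have hf : Continuous f := continuous_pi fun x => continuous_zeroEntState _
  have hint : Integrable f μ := integrable_of_continuous_of_compactSpace hf
  -- Only finitely many marginals are involved, so the average of `f` is taken in a
  -- finite-dimensional space.
  have hmem : ∫ p, f p ∂μ ∈ closure (convexHull ℝ (Set.range f)) :=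
    (convex_convexHull ℝ _).closure.integral_mem isClosed_closure
      (Eventually.of_forall fun p => subset_closure (subset_convexHull ℝ _ ⟨p, rfl⟩)) hint
  obtain ⟨y, hy, hyd⟩ := Metric.mem_closure_iff.1 hmem ε hε
  -- Carathéodory's theorem gives affinely independent, hence distinct, values `z i`; the underlying
  -- points of `ℂP^D` are then distinct too.
  obtain ⟨ι, hι, z, w, hz, hind, hw, hw1, rfl⟩ := eq_pos_convex_span_of_mem_convexHull hy
  have hv : ∀ i, ∃ v : UnitSphere D, f (ofSphere v) = z i := by
    intro i
    obtain ⟨p, hp⟩ := hz ⟨i, rfl⟩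
    obtain ⟨v, rfl⟩ := ofSphere_surjective p
    exact ⟨v, hp⟩
  choose v hv using hv
  refine ⟨ι, hι, w, v, fun i j hij => hind.injective ?_, fun i => (hw i).le, hw1, ?_⟩
  · rw [← hv, ← hv]
    exact congrArg f hij
  · intro k hk a b
    let x : F := ⟨⟨k, Nat.lt_succ_of_le hk⟩, a, b⟩
    rw [dist_comm, dist_eq_norm] at hyd
    refine lt_of_le_of_lt (le_of_eq_of_le ?_ (norm_le_pi_norm _ x)) hyd
    have h1 : (∫ p, f p ∂μ) x = marginals (mixture μ) k a b :=
      eval_integral (fun x => hint.eval x) x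
    have h2 : ∀ i, z i x = prodMarginals (v i).1 k a b := by
      intro i
      rw [← hv, ← marginals_zeroEntState_ofSphere]
    simp [h1, h2, Finset.sum_apply]

theorem mixture_mem_thermoStates (μ : Measure (CP D)) [IsProbabilityMeasure μ] :
    mixture μ ∈ thermoStates D := by
  refine mem_thermoStates_of_isApprox fun m => ?_
  obtain ⟨ι, hι, w, v, hv, hw, hw1, happrox⟩ :=
    exists_finite_mixture_approx μ m (ε := 1 / (m + 1 : ℝ)) (by positivity)
  have hne : ∀ᶠ N in atTop, superposition w v N ≠ 0 := by
    filter_upwards [(tendsto_inner_superposition_self hv hw hw1).eventually_ne one_ne_zero]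
      with N hN h0
    exact hN (by rw [h0, inner_zero_left])
  have hclose : ∀ k ≤ m, ∀ a b : Fin k → Fin (D + 1), ∀ᶠ N in atTop, ∀ h : k ≤ N,
      ‖vectorState (superposition w v N) (embed D k N h (matUnit a b)) -
        marginals (mixture μ) k a b‖ < 1 / (m + 1 : ℝ) := by
    intro k hk a b
    obtain ⟨n₀, hn₀⟩ := eventually_atTop.1
      (((tendsto_vectorState_superposition hv hw hw1 k a b).sub_const _).norm.eventually_lt_const
        (happrox k hk a b))
    filter_upwards [eventually_ge_atTop (k + n₀)] with N hN h
    obtain ⟨n, rfl⟩ := Nat.exists_eq_add_of_le h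
    exact hn₀ n (by omega)
  have hall : ∀ᶠ N in atTop, ∀ k : Fin (m + 1), ∀ a b : Fin k → Fin (D + 1), ∀ h : (k : ℕ) ≤ N,
      ‖vectorState (superposition w v N) (embed D k N h (matUnit a b)) -
        marginals (mixture μ) k a b‖ < 1 / (m + 1 : ℝ) :=
    eventually_all.2 fun k => eventually_all.2 fun a => eventually_all.2 fun b =>
      hclose k (Nat.le_of_lt_succ k.2) a b
  filter_upwards [hne, hall] with N hN hNall
  exact ⟨_, ⟨_, superposition_mem_symSubspace N, hN, rfl⟩,
    fun k hk h a b => hNall ⟨k, Nat.lt_succ_of_le hk⟩ a b h⟩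

end SpinChain
end

theorem theorem1 (D : ℕ) :
    (∀ ψ ∈ SpinChain.thermoStates D,
      ∃ μ : MeasureTheory.Measure (SpinChain.CP D),
        MeasureTheory.IsProbabilityMeasure μ ∧ SpinChain.Represents μ ψ) ∧
    (∀ μ : MeasureTheory.Measure (SpinChain.CP D), MeasureTheory.IsProbabilityMeasure μ →
      ∃! ψ : SpinChain.LocalOp D →ₗ[ℂ] ℂ,
        ψ ∈ SpinChain.thermoStates D ∧ SpinChain.Represents μ ψ) := by
  refine ⟨fun ψ hψ => SpinChain.exists_represents hψ, fun μ hμ => ?_⟩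
  refine ⟨SpinChain.mixture μ,
    ⟨SpinChain.mixture_mem_thermoStates μ, SpinChain.represents_mixture μ⟩, ?_⟩
  rintro ψ ⟨-, hψ⟩
  exact LinearMap.ext fun O => (hψ O).2
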